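/- Let $\mathbb S=\{s\in\mathbb C:|s|=1\}$, and for a topological abelian group $G$ let $G^\wedge$ denote the group of all continuous homomorphisms $G\to\mathbb S$. For an abelian group $A$ let $A^{(\mathbb N)}$ denote the group of all sequences in $A$ that are eventually equal to the neutral element. Let $X$ be an infinite compact metrizable topological abelian group. Let $c_0(X)$ be the group of all sequences in $X$ that converge to the neutral element $e$, let $\mathfrak u_0$ be the topology of uniform convergence on $\mathbb N$ on $c_0(X)$ (the group topology in which the sets $V^{\mathbb N}\cap c_0(X)$, with $V$ a neighbourhood of $e$ in $X$, form a neighbourhood basis at the neutral element), and put $G:=(c_0(X),\mathfrak u_0)$. Then: (1) $G$ is a Polish topological group that is locally quasi-convex and not precompact. Here $G$ is precompact if for each neighbourhood $U$ of its neutral element there is a finite $F\subset G$ with $FU=G$. It is locally quasi-convex if its neutral element has a neighbourhood basis of quasi-convex sets, where $A\subset G$ is quasi-convex if for each $x\in G\setminus A$ there is $\kappa\in G^\wedge$ with $\operatorname{Re}\kappa(a)\ge 0$ for all $a\in A$ and $\operatorname{Re}\kappa(x)<0$. (2) The following are equivalent: (i) $X$ is connected; (ii) $G^\wedge=(X^\wedge)^{(\mathbb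 N)}$, i.e. the canonical homomorphism $\chi:(X^\wedge)^{(\mathbb N)}\to G^\wedge$, $\chi\big((\xi_n)_n\big)\big((x_n)_n\big)=\prod_{n}\xi_n(x_n)$, is an isomorphism of groups; (iii) $\operatorname{Card} G^\wedge=\aleph_0$; (iv) $\operatorname{Card} G^\wedge<\mathfrak c$. (3) If $X$ is not connected, then $\operatorname{Card} G^\wedge=\mathfrak c$. -/

import Mathlib

open Filter Topology
open scoped UniformConvergence Pointwise Cardinal

universe u

/-- `c₀(X)`: the group of all sequences in the (multiplicatively written) topological abelian
group `X` that converge to the neutral element. It is a subgroup of `ℕ →ᵤ X`, the group of all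
sequences of `X`. -/
def NullSeq (X : Type u) [CommGroup X] [TopologicalSpace X] [IsTopologicalGroup X] :
    Subgroup (ℕ →ᵤ X) where
  carrier := {x | Tendsto (UniformFun.toFun x) atTop (𝓝 1)}
  mul_mem' := by
    intro a b ha hb
    have h := Tendsto.mul (show Tendsto (UniformFun.toFun a) atTop (𝓝 1) from ha)
      (show Tendsto (UniformFun.toFun b) atTop (𝓝 1) from hb)
    rw [mul_one] at h
    exact h
  one_mem' := tendsto_const_nhds
  inv_mem' := by
    intro a ha
    have h := Tendsto.inv (show Tendsto (UniformFun.toFun a) atTop (𝓝 1) from ha)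
    rw [inv_one] at h
    exact h

namespace NullSeq

variable {X : Type u} [CommGroup X] [TopologicalSpace X] [IsTopologicalGroup X]

/-- The topology `𝔲₀` of `c₀(X)`: uniform convergence on `ℕ`, with respect to the canonical uniform
structure of the topological abelian group `X`. -/
instance instTopologicalSpace : TopologicalSpace (NullSeq X) :=
  letI : UniformSpace X := IsTopologicalGroup.rightUniformSpace X
  TopologicalSpace.induced (fun x : NullSeq X => (x : ℕ →ᵤ X)) (UniformFun.topologicalSpace ℕ X)

instance instIsTopologicalGroup : IsTopologicalGroup (NullSeq X) :=
  letI : UniformSpace X := IsTopologicalGroup.rightUniformSpace X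
  haveI : IsUniformGroup X := isUniformGroup_of_commGroup
  topologicalGroup_induced (NullSeq X).subtype

/-- The sets `V^ℕ ∩ c₀(X)`, for `V` a neighbourhood of the neutral element of `X`, form a basis of
neighbourhoods of the neutral element of `c₀(X)`. -/
theorem hasBasis_nhds_one :
    (𝓝 (1 : NullSeq X)).HasBasis (fun V : Set X => V ∈ 𝓝 (1 : X))
      (fun V => {x : NullSeq X | ∀ n, UniformFun.toFun (x : ℕ →ᵤ X) n ∈ V}) := by
  let _ : UniformSpace X := IsTopologicalGroup.rightUniformSpace X
  have _ : IsUniformGroup X := isUniformGroup_of_commGroup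
  have h := (UniformFun.hasBasis_nhds_one (α := ℕ) (G := X)).comap
    (fun x : NullSeq X => (x : ℕ →ᵤ X))
  rw [nhds_induced]
  exact h

/-- The `n`-th coordinate, as a homomorphism `c₀(X) → X`. -/
def coord (n : ℕ) : NullSeq X →* X where
  toFun x := UniformFun.toFun (x : ℕ →ᵤ X) n
  map_one' := rfl
  map_mul' _ _ := rfl

theorem continuous_coord (n : ℕ) : Continuous (coord (X := X) n) := by
  refine continuous_of_continuousAt_one (coord (X := X) n) ?_
  unfold ContinuousAt
  rw [map_one]
  intro V hV
  have h := (hasBasis_nhds_one (X := X)).mem_of_mem hV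
  rw [mem_map]
  filter_upwards [h] with x hx
  exact hx n

end NullSeq

/-- `A^(ℕ)`: the subgroup of `A^ℕ` of all sequences that are eventually equal to the neutral
element. -/
def EventuallyOneSeq (A : Type u) [CommGroup A] : Subgroup (ℕ → A) where
  carrier := {h | ∀ᶠ n in atTop, h n = 1}
  mul_mem' := by
    intro a b ha hb
    filter_upwards [ha, hb] with n h1 h2
    simp [h1, h2]
  one_mem' := Eventually.of_forall fun _ => rfl
  inv_mem' := by
    intro a ha
    filter_upwards [ha] with n h1
    simp [h1]

theorem EventuallyOneSeq.finite_mulSupport {A : Type u} [CommGroup A] (h : EventuallyOneSeq A) :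
    (Function.mulSupport (h : ℕ → A)).Finite := by
  have := h.2
  change ∀ᶠ n in atTop, (h : ℕ → A) n = 1 at this
  rwa [← Nat.cofinite_eq_atTop, eventually_cofinite] at this

namespace NullSeq

variable {X : Type u} [CommGroup X] [TopologicalSpace X] [IsTopologicalGroup X]

theorem finite_mulSupport_apply (h : EventuallyOneSeq (PontryaginDual X)) (x : NullSeq X) :
    (Function.mulSupport fun n => (h : ℕ → PontryaginDual X) n (coord n x)).Finite :=
  (EventuallyOneSeq.finite_mulSupport h).subset fun n hn => by
    intro h1
    apply hn
    change (h : ℕ → PontryaginDual X) n (coord n x) = 1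
    rw [h1]
    rfl

/-- The continuous character `χ_h : x ↦ ∏ₙ ξₙ(xₙ)` of `c₀(X)` given by an eventually trivial
sequence `h = (ξₙ)` of continuous characters of `X`. -/
noncomputable def chiChar (h : EventuallyOneSeq (PontryaginDual X)) :
    NullSeq X →ₜ* Circle where
  toFun x := ∏ᶠ n, (h : ℕ → PontryaginDual X) n (coord n x)
  map_one' := by simp
  map_mul' x y := by
    simp only [map_mul]
    exact finprod_mul_distrib (finite_mulSupport_apply h x) (finite_mulSupport_apply h y)
  continuous_toFun := by
    have hs : ∀ x : NullSeq X, ∏ᶠ n, (h : ℕ → PontryaginDual X) n (coord n x) =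
        ∏ n ∈ (EventuallyOneSeq.finite_mulSupport h).toFinset, (h : ℕ → PontryaginDual X) n (coord n x) := by
      intro x
      apply finprod_eq_prod_of_mulSupport_subset
      intro n hn
      simp only [Set.Finite.coe_toFinset, Function.mem_mulSupport]
      intro h1
      apply hn
      change (h : ℕ → PontryaginDual X) n (coord n x) = 1
      rw [h1]
      rfl
    simp only [hs]
    exact continuous_finsetProd _ fun n _ =>
      (map_continuous ((h : ℕ → PontryaginDual X) n)).comp (continuous_coord n)

/-- The canonical homomorphism `χ : (X^)^(ℕ) → c₀(X)^`, `h ↦ χ_h`. -/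
noncomputable def chi (X : Type u) [CommGroup X] [TopologicalSpace X] [IsTopologicalGroup X] :
    EventuallyOneSeq (PontryaginDual X) →* PontryaginDual (NullSeq X) where
  toFun h := chiChar h
  map_one' := by
    apply PontryaginDual.ext
    intro x
    change ∏ᶠ n, (1 : PontryaginDual X) (coord n x) = 1
    simp
  map_mul' h k := by
    apply PontryaginDual.ext
    intro x
    exact finprod_mul_distrib (finite_mulSupport_apply h x) (finite_mulSupport_apply k x)

end NullSeq

/-- A topological abelian group is precompact if each neighbourhood of the neutral element covers
the group by finitely many translates. -/
def IsPrecompactGroup (G : Type u) [CommGroup G] [TopologicalSpace G] : Prop :=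
  ∀ U ∈ 𝓝 (1 : G), ∃ F : Set G, F.Finite ∧ F * U = Set.univ

/-- A subset `A` of a topological abelian group `G` is quasi-convex if each point outside of `A`
is separated from `A` by a continuous character, in the sense that the character maps `A` into
`{s : Re s ≥ 0}` but not the point. -/
def IsQuasiConvex {G : Type u} [CommGroup G] [TopologicalSpace G] (A : Set G) : Prop :=
  ∀ x, x ∉ A → ∃ κ : PontryaginDual G,
    (∀ a ∈ A, 0 ≤ (κ a : ℂ).re) ∧ ¬ 0 ≤ (κ x : ℂ).re

/-- A topological abelian group is locally quasi-convex if the neutral element has a basis of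
neighbourhoods that consists of quasi-convex sets. -/
def IsLocallyQuasiConvex (G : Type u) [CommGroup G] [TopologicalSpace G] : Prop :=
  (𝓝 (1 : G)).HasBasis (fun A : Set G => A ∈ 𝓝 (1 : G) ∧ IsQuasiConvex A) id

/-! Everything rests on the fact that continuous characters of a compact Hausdorff abelian group
separate points (`exists_pontryaginDual_apply_ne_one`). It is derived from Gelfand theory:
translations and convolutions generate a commutative algebra of operators on `C(X, ℂ)`, and an
algebra character that does not kill convolution by `f` restricts to a multiplicative function on
the translations. Such a character exists because `f* * f` is self-adjoint for the `L²` product, so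
the norms of its powers decay at most geometrically. By compactness, finitely many characters then
cut out arbitrarily small neighbourhoods in `X`; applied coordinatewise, they give local
quasi-convexity. Pigeonhole on the sequences supported at one index refutes precompactness. `c₀(X)`
is Polish as a closed, separable subspace of a completely metrizable one. A character of `c₀(X)` is
determined by its restrictions to the coordinates, as truncations converge uniformly. If `X` is
connected, a symmetric neighbourhood `V` satisfies `V ^ m = X`, so every nontrivial character turns
some point of `V` by an angle at least `1 / (m + 1)`. Infinitely many nontrivial restrictions would
then let the angles add up past `π / 2` within `V^ℕ`, contradicting continuity. Hence `chi` is onto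
and the dual is countable. If `X` is disconnected, it has a nontrivial character `ξ` with open
kernel. Since `ξ(xₙ) = 1` eventually, the product of `ξ(xₙ)` over any set of indices is a continuous
character, which yields `𝔠` of them; separability gives the upper bound. -/

/-! ### Characters of commutative Banach algebras -/

section GelfandCharacters

/-- The growth bound makes the spectral radius of `a` positive, and each spectral value is the value
of an algebra character. -/
theorem exists_algHom_apply_ne_zero_of_le_norm_pow {A : Type*} [NormedCommRing A]
    [NormedAlgebra ℂ A] [CompleteSpace A] {a : A} {c r : ℝ} (hc : 0 < c) (hr : 0 < r)
    (h : ∀ n : ℕ, c * r ^ n ≤ ‖a ^ n‖) : ∃ φ : A →ₐ[ℂ] ℂ, φ a ≠ 0 := by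
  have : Nontrivial A := ⟨a ^ 0, 0, fun h0 => by
    have := h 0
    rw [h0] at this
    simp at this
    linarith⟩
  obtain ⟨z, hz, hzr⟩ := spectrum.exists_nnnorm_eq_spectralRadius a
  obtain ⟨φ, hφ⟩ := WeakDual.CharacterSpace.mem_spectrum_iff_exists.1 hz
  refine ⟨WeakDual.CharacterSpace.toAlgHom φ, ?_⟩
  change φ a ≠ 0
  rw [hφ]
  -- With spectral radius zero, `‖a ^ n‖ < (r / 2) ^ n` eventually, which forces `c * 2 ^ n < 1`.
  rintro rfl
  have ht := spectrum.pow_norm_pow_one_div_tendsto_nhds_spectralRadius a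
  rw [← hzr] at ht
  simp only [nnnorm_zero, ENNReal.coe_zero] at ht
  have h1 := ht.eventually (gt_mem_nhds (ENNReal.ofReal_pos.2 (half_pos hr)))
  have h2 : Tendsto (fun n : ℕ => c * 2 ^ n) atTop atTop :=
    (tendsto_pow_atTop_atTop_of_one_lt one_lt_two).const_mul_atTop hc
  obtain ⟨n, ⟨hn1, hn2⟩, hn⟩ := ((h1.and (h2.eventually_gt_atTop 1)).and (eventually_gt_atTop 0)).exists
  rw [ENNReal.ofReal_lt_ofReal_iff (half_pos hr)] at hn1
  have h3 : ‖a ^ n‖ < (r / 2) ^ n := by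
    have := pow_lt_pow_left₀ hn1 (by positivity) hn.ne'
    rwa [one_div, Real.rpow_inv_natCast_pow (norm_nonneg _) hn.ne'] at this
  have h4 := (h n).trans_lt h3
  rw [div_pow, lt_div_iff₀ (by positivity)] at h4
  have h5 : 0 < r ^ n := by positivity
  nlinarith

/-- The closure of the generated subalgebra is a commutative Banach algebra, and its characters are
contractive. -/
theorem exists_algHom_adjoin_apply_ne_zero {B : Type*} [NormedRing B] [NormedAlgebra ℂ B]
    [CompleteSpace B] [NormOneClass B] {s : Set B} (hs : ∀ a ∈ s, ∀ b ∈ s, a * b = b * a)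
    (a : Algebra.adjoin ℂ s) {c r : ℝ} (hc : 0 < c) (hr : 0 < r)
    (h : ∀ n : ℕ, c * r ^ n ≤ ‖(a : B) ^ n‖) :
    ∃ φ : Algebra.adjoin ℂ s →ₐ[ℂ] ℂ, (∀ b, ‖φ b‖ ≤ ‖(b : B)‖) ∧ φ a ≠ 0 := by
  let S := Algebra.adjoin ℂ s
  have hS : ∀ x y : S, x * y = y * x := (Algebra.isMulCommutative_adjoin ℂ hs).is_comm.comm
  let A := S.topologicalClosure
  let _ : NormedCommRing A :=
    { (inferInstance : NormedRing A) with
      mul_comm := (S.commRingTopologicalClosure hS).mul_comm }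
  let _ : NormedAlgebra ℂ A := { (inferInstance : Algebra ℂ A) with
    norm_smul_le := fun z x => norm_smul_le z (x : B) }
  have : CompleteSpace A := S.isClosed_topologicalClosure.completeSpace_coe
  have : NormOneClass A := ⟨norm_one (α := B)⟩
  let ι : S →ₐ[ℂ] A := Subalgebra.inclusion S.le_topologicalClosure
  obtain ⟨φ, hφ⟩ := exists_algHom_apply_ne_zero_of_le_norm_pow (a := ι a) hc hr h
  refine ⟨φ.comp ι, fun b => ?_, hφ⟩
  exact AlgHom.norm_apply_le_self φ (ι b)

/-- An algebra character applied to `T x * L k = L (R x k)` turns this operator identity into an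
eigenvalue equation. -/
theorem exists_eigenfunctional_of_commute {X V B : Type*} [Group X] [NormedAddCommGroup V]
    [NormedSpace ℂ V] [NormedRing B] [NormedAlgebra ℂ B] [CompleteSpace B] [NormOneClass B]
    (T : X →* B) (L : V →L[ℂ] B) (R : X → V → V) (hTT : ∀ x y, Commute (T x) (T y))
    (hTL : ∀ x k, Commute (T x) (L k)) (hLL : ∀ k k', Commute (L k) (L k'))
    (hT : ∀ x, ‖T x‖ ≤ 1) (hR : ∀ x k, T x * L k = L (R x k)) {f f' : V} {c r : ℝ}
    (hc : 0 < c) (hr : 0 < r) (h : ∀ n : ℕ, c * r ^ n ≤ ‖(L f' * L f) ^ n‖) :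
    ∃ (ψ : X →* ℂ) (l : V →L[ℂ] ℂ), (∀ x, ‖ψ x‖ ≤ 1) ∧
      (∀ x k, ψ x * l k = l (R x k)) ∧ l f ≠ 0 := by
  let s : Set B := Set.range T ∪ Set.range L
  have hs : ∀ a ∈ s, ∀ b ∈ s, a * b = b * a := by
    rintro _ (⟨a, rfl⟩ | ⟨a, rfl⟩) _ (⟨b, rfl⟩ | ⟨b, rfl⟩)
    · exact hTT a b
    · exact hTL a b
    · exact (hTL b a).symm
    · exact hLL a b
  let T' : X → Algebra.adjoin ℂ s := fun y => ⟨T y, Algebra.subset_adjoin (Or.inl ⟨y, rfl⟩)⟩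
  let L' : V → Algebra.adjoin ℂ s := fun k => ⟨L k, Algebra.subset_adjoin (Or.inr ⟨k, rfl⟩)⟩
  obtain ⟨φ, hφ, hφS⟩ := exists_algHom_adjoin_apply_ne_zero hs (L' f' * L' f) hc hr h
  rw [map_mul] at hφS
  let ψ : X →* ℂ :=
    { toFun := fun y => φ (T' y)
      map_one' := by
        rw [← map_one φ]
        exact congrArg φ (Subtype.ext (map_one T))
      map_mul' := fun y z => by
        rw [← map_mul]
        exact congrArg φ (Subtype.ext (map_mul T y z)) }
  let l : V →ₗ[ℂ] ℂ :=
    { toFun := fun k => φ (L' k)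
      map_add' := fun k k' => by
        rw [← map_add]
        exact congrArg φ (Subtype.ext (map_add L k k'))
      map_smul' := fun c k => by
        rw [RingHom.id_apply, ← map_smul]
        exact congrArg φ (Subtype.ext (map_smul L c k)) }
  refine ⟨ψ, l.mkContinuous ‖L‖ fun k => (hφ (L' k)).trans (L.le_opNorm k),
    fun y => (hφ (T' y)).trans (hT y), fun y k => ?_, right_ne_zero_of_mul hφS⟩
  change φ (T' y) * φ (L' k) = φ (L' (R y k))
  rw [← map_mul]
  exact congrArg φ (Subtype.ext (hR y k))

end GelfandCharacters

/-! ### Convolution operators on a compact abelian group -/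

section Convolution

open MeasureTheory

theorem integrable_of_continuous {Y E : Type*} [TopologicalSpace Y] [CompactSpace Y]
    [MeasurableSpace Y] [BorelSpace Y] [NormedAddCommGroup E] (μ : Measure Y)
    [IsFiniteMeasure μ] {f : Y → E} (hf : Continuous f) : Integrable f μ :=
  hf.integrable_of_hasCompactSupport (HasCompactSupport.of_compactSpace f)

variable {X : Type u} [CommGroup X] [TopologicalSpace X] [IsTopologicalGroup X]

/-- The reflected conjugate `x ↦ conj (f x⁻¹)`. -/
noncomputable def conjInv (f : C(X, ℂ)) : C(X, ℂ) :=
  ⟨fun x => (starRingEnd ℂ) (f x⁻¹), by fun_prop⟩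

@[simp] theorem conjInv_apply (f : C(X, ℂ)) (x : X) :
    conjInv f x = (starRingEnd ℂ) (f x⁻¹) := rfl

variable [CompactSpace X]

/-- Translation of continuous functions on a compact abelian group: `h ↦ (y ↦ h (x⁻¹ * y))`. -/
noncomputable def translation (x : X) : C(X, ℂ) →L[ℂ] C(X, ℂ) :=
  LinearMap.mkContinuous
    { toFun := fun h => h.comp ⟨fun y => x⁻¹ * y, by fun_prop⟩
      map_add' := fun _ _ => rfl
      map_smul' := fun _ _ => rfl } 1 (fun h => by
        rw [one_mul, ContinuousMap.norm_le _ (norm_nonneg _)]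
        exact fun y => h.norm_coe_le_norm _)

@[simp] theorem translation_apply (x : X) (h : C(X, ℂ)) (y : X) :
    translation x h y = h (x⁻¹ * y) := rfl

theorem norm_translation_le (x : X) : ‖(translation x : C(X, ℂ) →L[ℂ] C(X, ℂ))‖ ≤ 1 :=
  LinearMap.mkContinuous_norm_le _ zero_le_one _

theorem translation_one : (translation (1 : X)) = 1 := by
  ext h y
  simp

theorem translation_mul (x y : X) : translation (x * y) = translation x * translation y := by
  ext h z
  change h ((x * y)⁻¹ * z) = h (y⁻¹ * (x⁻¹ * z))
  rw [mul_inv_rev, mul_assoc]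

theorem continuous_translation_apply (h : C(X, ℂ)) : Continuous fun x => translation x h :=
  ContinuousMap.continuous_of_continuous_uncurry _ (by
    change Continuous fun p : X × X => h (p.1⁻¹ * p.2)
    fun_prop)

theorem continuous_smul_translation (f h : C(X, ℂ)) : Continuous fun x => f x • translation x h :=
  f.continuous.smul (continuous_translation_apply h)

theorem commute_translation (x y : X) : Commute (translation x) (translation y) := by
  rw [Commute, SemiconjBy, ← translation_mul, ← translation_mul, mul_comm]

variable [MeasurableSpace X] [BorelSpace X]

/-- Convolution by a continuous function, as an operator on continuous functions. -/
noncomputable def convolutionOp (μ : Measure X) [IsProbabilityMeasure μ] :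
    C(X, ℂ) →L[ℂ] C(X, ℂ) →L[ℂ] C(X, ℂ) :=
  LinearMap.mkContinuous₂
    (LinearMap.mk₂ ℂ (fun f h => ∫ x, f x • translation x h ∂μ)
      (fun f g h => by
        simp only [ContinuousMap.add_apply, add_smul]
        exact integral_add (integrable_of_continuous μ (continuous_smul_translation f h))
          (integrable_of_continuous μ (continuous_smul_translation g h)))
      (fun c f h => by
        simp only [ContinuousMap.smul_apply, smul_assoc]
        exact integral_smul _ _)
      (fun f g h => by
        simp only [map_add, smul_add]
        exact integral_add (integrable_of_continuous μ (continuous_smul_translation f g))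
          (integrable_of_continuous μ (continuous_smul_translation f h)))
      (fun c f h => by
        simp only [map_smul, smul_comm _ c]
        exact integral_smul _ _)) 1 (fun f h => by
        refine (norm_integral_le_of_norm_le_const (C := ‖f‖ * ‖h‖)
          (Eventually.of_forall fun x => ?_)).trans ?_
        · rw [norm_smul]
          refine mul_le_mul (f.norm_coe_le_norm x) ?_ (norm_nonneg _) (norm_nonneg _)
          simpa using (translation x).le_of_opNorm_le (norm_translation_le x) h
        · simp)

theorem convolutionOp_apply (μ : Measure X) [IsProbabilityMeasure μ] (f h : C(X, ℂ)) :
    convolutionOp μ f h = ∫ x, f x • translation x h ∂μ := rfl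

theorem convolutionOp_apply_apply (μ : Measure X) [IsProbabilityMeasure μ] (f h : C(X, ℂ))
    (y : X) : convolutionOp μ f h y = ∫ x, f x * h (x⁻¹ * y) ∂μ := by
  rw [convolutionOp_apply]
  exact ((ContinuousMap.evalCLM ℂ y).integral_comp_comm
    (integrable_of_continuous μ (continuous_smul_translation f h))).symm

/-- A convolution is an integral of translations, and `T` passes under the integral. Used twice,
this makes convolutions commute with each other without Fubini. -/
theorem commute_convolutionOp (μ : Measure X) [IsProbabilityMeasure μ]
    {T : C(X, ℂ) →L[ℂ] C(X, ℂ)} (hT : ∀ x, Commute T (translation x)) (f : C(X, ℂ)) :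
    Commute T (convolutionOp μ f) := by
  ext1 h
  change T (∫ x, f x • translation x h ∂μ) = ∫ x, f x • translation x (T h) ∂μ
  rw [← T.integral_comp_comm (integrable_of_continuous μ (continuous_smul_translation f h))]
  refine integral_congr_ae (Eventually.of_forall fun x => ?_)
  change T (f x • translation x h) = _
  rw [map_smul]
  exact congrArg _ (DFunLike.congr_fun (hT x) h)

theorem commute_translation_convolutionOp (μ : Measure X) [IsProbabilityMeasure μ] (x : X)
    (f : C(X, ℂ)) : Commute (translation x) (convolutionOp μ f) :=
  commute_convolutionOp μ (commute_translation x) f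

theorem commute_convolutionOp_convolutionOp (μ : Measure X) [IsProbabilityMeasure μ]
    (f g : C(X, ℂ)) : Commute (convolutionOp μ f) (convolutionOp μ g) :=
  commute_convolutionOp μ (fun x => (commute_translation_convolutionOp μ x f).symm) g

theorem translation_mul_convolutionOp (μ : Measure X) [IsProbabilityMeasure μ]
    [μ.IsMulLeftInvariant] (x : X) (f : C(X, ℂ)) :
    translation x * convolutionOp μ f = convolutionOp μ (translation x f) := by
  ext h y
  change convolutionOp μ f h (x⁻¹ * y) = _
  rw [convolutionOp_apply_apply, convolutionOp_apply_apply,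
    ← integral_mul_left_eq_self (fun z => translation x f z * h (z⁻¹ * y)) x]
  simp only [translation_apply, inv_mul_cancel_left, mul_inv_rev, mul_assoc]

/-- The `L²` inner product of continuous functions. -/
noncomputable def innerL2 (μ : Measure X) (h k : C(X, ℂ)) : ℂ :=
  ∫ x, (starRingEnd ℂ) (h x) * k x ∂μ

/-- Fubini and invariance of the measure: convolution by `conjInv f` is the `L²` adjoint of
convolution by `f`. -/
theorem innerL2_convolutionOp_left (μ : Measure X) [IsProbabilityMeasure μ]
    [μ.IsMulLeftInvariant] [μ.IsInvInvariant] (f h k : C(X, ℂ)) :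
    innerL2 μ (convolutionOp μ f h) k = innerL2 μ h (convolutionOp μ (conjInv f) k) := by
  have h1 : innerL2 μ (convolutionOp μ f h) k =
      ∫ y, ∫ x, (starRingEnd ℂ) (f x) * (starRingEnd ℂ) (h (x⁻¹ * y)) * k y ∂μ ∂μ := by
    refine integral_congr_ae (Eventually.of_forall fun y => ?_)
    simp only [convolutionOp_apply_apply]
    rw [← integral_conj, ← integral_mul_const]
    simp only [map_mul]
  have h2 : innerL2 μ h (convolutionOp μ (conjInv f) k) =
      ∫ y, ∫ x, (starRingEnd ℂ) (h y) * ((starRingEnd ℂ) (f x) * k (x * y)) ∂μ ∂μ := by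
    refine integral_congr_ae (Eventually.of_forall fun y => ?_)
    simp only [convolutionOp_apply_apply]
    rw [← integral_const_mul, ← integral_inv_eq_self _ μ]
    simp only [conjInv_apply, inv_inv]
  rw [h1, h2, integral_integral_swap_of_hasCompactSupport (by fun_prop)
    (HasCompactSupport.of_compactSpace _)]
  refine Eq.trans ?_ (integral_integral_swap_of_hasCompactSupport (by fun_prop)
    (HasCompactSupport.of_compactSpace _)).symm
  refine integral_congr_ae (Eventually.of_forall fun x => ?_)
  simp only
  rw [← integral_mul_left_eq_self _ x]
  refine integral_congr_ae (Eventually.of_forall fun y => ?_)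
  simp only [inv_mul_cancel_left]
  ring

end Convolution

/-! ### Lower bounds for powers of positive convolution operators -/

/-- For a log-convex sequence the successive ratios do not decrease, so each is at least the first.
-/
theorem geometric_le_of_sq_le_mul {a : ℕ → ℝ} (h0 : 0 < a 0) (h1 : 0 < a 1)
    (h : ∀ n, a (n + 1) ^ 2 ≤ a n * a (n + 2)) (n : ℕ) : a 0 * (a 1 / a 0) ^ n ≤ a n := by
  have key : ∀ n, 0 < a n ∧ a 1 / a 0 * a n ≤ a (n + 1) := by
    intro n
    induction n with
    | zero => exact ⟨h0, (div_mul_cancel₀ _ h0.ne').le⟩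
    | succ n ih =>
      obtain ⟨hn, hn1⟩ := ih
      have hp : 0 < a (n + 1) := (mul_pos (div_pos h1 h0) hn).trans_le hn1
      refine ⟨hp, le_of_mul_le_mul_left ?_ hn⟩
      calc a n * (a 1 / a 0 * a (n + 1)) = (a 1 / a 0 * a n) * a (n + 1) := by ring
        _ ≤ a (n + 1) * a (n + 1) := by gcongr
        _ = a (n + 1) ^ 2 := (sq _).symm
        _ ≤ _ := h n
  induction n with
  | zero => simp
  | succ n ih =>
    refine le_trans ?_ (key n).2
    rw [pow_succ, mul_comm (a 1 / a 0), ← mul_assoc]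
    have := div_pos h1 h0
    gcongr

section Separation

open MeasureTheory

theorem innerL2_eq_inner {X : Type u} [TopologicalSpace X] [CompactSpace X] [MeasurableSpace X]
    [BorelSpace X] (μ : Measure X) [IsProbabilityMeasure μ] (h k : C(X, ℂ)) :
    innerL2 μ h k = inner ℂ (ContinuousMap.toLp (E := ℂ) 2 μ ℂ h)
      (ContinuousMap.toLp (E := ℂ) 2 μ ℂ k) := by
  rw [ContinuousMap.inner_toLp]
  simp only [innerL2, mul_comm]

variable {X : Type u} [CommGroup X] [TopologicalSpace X] [IsTopologicalGroup X]

theorem conjInv_conjInv (f : C(X, ℂ)) : conjInv (conjInv f) = f := by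
  ext x
  simp

variable [CompactSpace X] [MeasurableSpace X] [BorelSpace X]

/-- The operator `h ↦ conjInv f * (f * h)`. -/
noncomputable def posConvolutionOp (μ : Measure X) [IsProbabilityMeasure μ] (f : C(X, ℂ)) :
    C(X, ℂ) →L[ℂ] C(X, ℂ) :=
  convolutionOp μ (conjInv f) * convolutionOp μ f

theorem innerL2_posConvolutionOp (μ : Measure X) [IsProbabilityMeasure μ]
    [μ.IsMulLeftInvariant] [μ.IsInvInvariant] (f h k : C(X, ℂ)) :
    innerL2 μ (posConvolutionOp μ f h) k = innerL2 μ h (posConvolutionOp μ f k) := by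
  change innerL2 μ (convolutionOp μ (conjInv f) (convolutionOp μ f h)) k =
    innerL2 μ h (convolutionOp μ (conjInv f) (convolutionOp μ f k))
  rw [innerL2_convolutionOp_left, conjInv_conjInv, innerL2_convolutionOp_left]

theorem posConvolutionOp_conjInv_ne_zero (μ : Measure X) [IsProbabilityMeasure μ]
    [μ.IsMulLeftInvariant] [μ.IsInvInvariant] [μ.IsOpenPosMeasure] {f : C(X, ℂ)} (hf : f ≠ 0) :
    posConvolutionOp μ f (conjInv f) ≠ 0 := by
  have hinj := ContinuousMap.toLp_injective (E := ℂ) (p := 2) (𝕜 := ℂ) μ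
  have hself : ∀ h : C(X, ℂ), innerL2 μ h h = 0 → h = 0 := fun h hh => by
    rw [innerL2_eq_inner, inner_self_eq_zero] at hh
    exact hinj (hh.trans (map_zero _).symm)
  intro h0
  have h1 : convolutionOp μ f (conjInv f) = 0 := by
    apply hself
    rw [innerL2_convolutionOp_left]
    change innerL2 μ (conjInv f) (posConvolutionOp μ f (conjInv f)) = 0
    rw [h0]
    simp [innerL2]
  apply hf
  apply hself
  -- The value of `f * conjInv f` at the neutral element is the squared `L²` norm of `f`.
  have h2 := DFunLike.congr_fun h1 (1 : X)
  rw [convolutionOp_apply_apply] at h2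
  rw [← ContinuousMap.zero_apply (1 : X), ← h2]
  refine integral_congr_ae (Eventually.of_forall fun x => ?_)
  simp [mul_comm]

theorem exists_le_norm_posConvolutionOp_pow (μ : Measure X) [IsProbabilityMeasure μ]
    [μ.IsMulLeftInvariant] [μ.IsInvInvariant] [μ.IsOpenPosMeasure] {f : C(X, ℂ)} (hf : f ≠ 0) :
    ∃ c r : ℝ, 0 < c ∧ 0 < r ∧ ∀ n : ℕ, c * r ^ n ≤ ‖posConvolutionOp μ f ^ n‖ := by
  set S := posConvolutionOp μ f with hS
  set h := conjInv f with hh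
  let v := ContinuousMap.toLp (E := ℂ) 2 μ ℂ
  have hinj : Function.Injective v := ContinuousMap.toLp_injective (E := ℂ) (p := 2) (𝕜 := ℂ) μ
  have hpos : ∀ k : C(X, ℂ), k ≠ 0 → 0 < ‖v k‖ := fun k hk =>
    norm_pos_iff.2 fun h0 => hk (hinj (h0.trans (map_zero _).symm))
  have hSh : S h ≠ 0 := posConvolutionOp_conjInv_ne_zero μ hf
  have hh0 : h ≠ 0 := fun h0 => hSh (by rw [h0, map_zero])
  have ha0 : 0 < ‖v ((S ^ 0) h)‖ := hpos _ hh0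
  have ha1 : 0 < ‖v ((S ^ 1) h)‖ := by
    rw [pow_one]
    exact hpos _ hSh
  -- Self-adjointness moves one factor `S` across the inner product; Cauchy–Schwarz gives
  -- log-convexity.
  have hlog : ∀ n, ‖v ((S ^ (n + 1)) h)‖ ^ 2 ≤ ‖v ((S ^ n) h)‖ * ‖v ((S ^ (n + 2)) h)‖ := by
    intro n
    have hsucc : ∀ m, (S ^ (m + 1)) h = S ((S ^ m) h) := fun m => by rw [pow_succ']; rfl
    have h1 : inner ℂ (v ((S ^ (n + 1)) h)) (v ((S ^ (n + 1)) h)) =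
        inner ℂ (v ((S ^ n) h)) (v ((S ^ (n + 2)) h)) := by
      rw [← innerL2_eq_inner, ← innerL2_eq_inner, hsucc (n + 1)]
      conv_lhs => rw [hsucc n]
      rw [hS, innerL2_posConvolutionOp, ← hS, hsucc n]
    have h2 := norm_inner_le_norm (𝕜 := ℂ) (v ((S ^ n) h)) (v ((S ^ (n + 2)) h))
    rw [← h1, inner_self_eq_norm_sq_to_K] at h2
    simpa using h2
  have hC : 0 < ‖v‖ + 1 := by positivity
  have hhn : 0 < ‖h‖ := norm_pos_iff.2 hh0
  -- The denominator compares `L²` norms with sup norms; the `+ 1` only makes it visibly positive.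
  refine ⟨‖v ((S ^ 0) h)‖ / ((‖v‖ + 1) * ‖h‖), _, by positivity, div_pos ha1 ha0, fun n => ?_⟩
  rw [div_mul_eq_mul_div, div_le_iff₀ (by positivity)]
  refine (geometric_le_of_sq_le_mul (a := fun n => ‖v ((S ^ n) h)‖) ha0 ha1 hlog n).trans ?_
  calc ‖v ((S ^ n) h)‖ ≤ ‖v‖ * ‖(S ^ n) h‖ := v.le_opNorm _
    _ ≤ (‖v‖ + 1) * (‖S ^ n‖ * ‖h‖) := by
        gcongr
        · linarith
        · exact (S ^ n).le_opNorm _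
    _ = _ := by ring

end Separation

/-! ### Characters separate the points of a compact abelian group -/

section PeterWeyl

open MeasureTheory

/-- A continuous multiplicative map to `ℂ` that is bounded by one is a continuous character. -/
theorem exists_pontryaginDual_eq {X : Type u} [CommGroup X] [TopologicalSpace X] (φ : X →* ℂ)
    (hφ : ∀ x, ‖φ x‖ ≤ 1) (hc : Continuous φ) :
    ∃ χ : PontryaginDual X, ∀ x, (χ x : ℂ) = φ x := by
  have h1 : ∀ x, ‖φ x‖ = 1 := fun x => by
    refine le_antisymm (hφ x) ?_
    have h2 : ‖φ x‖ * ‖φ x⁻¹‖ = 1 := by rw [← norm_mul, ← map_mul]; simp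
    nlinarith [hφ x, hφ x⁻¹, norm_nonneg (φ x), norm_nonneg (φ x⁻¹)]
  let f : X →ₜ* Circle :=
    { toFun := fun x => ⟨φ x, mem_sphere_zero_iff_norm.2 (h1 x)⟩
      map_one' := Subtype.ext (map_one φ)
      map_mul' := fun x y => Subtype.ext (map_mul φ x y)
      continuous_toFun := hc.subtype_mk _ }
  exact ⟨f, fun x => rfl⟩

variable {X : Type u} [CommGroup X] [TopologicalSpace X] [IsTopologicalGroup X] [CompactSpace X]

/-- For each `f ≠ 0` there is a bounded multiplicative map `ψ` on the group and a functional, an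
eigenvector of translations with eigenvalues `ψ`, that does not vanish at `f`. -/
theorem exists_eigenfunctional [MeasurableSpace X] [BorelSpace X] (μ : Measure X)
    [IsProbabilityMeasure μ] [μ.IsMulLeftInvariant] [μ.IsInvInvariant] [μ.IsOpenPosMeasure]
    {f : C(X, ℂ)} (hf : f ≠ 0) :
    ∃ (ψ : X →* ℂ) (l : C(X, ℂ) →L[ℂ] ℂ), (∀ x, ‖ψ x‖ ≤ 1) ∧
      (∀ x k, ψ x * l k = l (translation x k)) ∧ l f ≠ 0 := by
  have : Nonempty X := ⟨1⟩
  obtain ⟨c, r, hc, hr, hcr⟩ := exists_le_norm_posConvolutionOp_pow μ hf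
  exact exists_eigenfunctional_of_commute
    { toFun := translation, map_one' := translation_one, map_mul' := translation_mul }
    (convolutionOp μ) (fun x k => translation x k) commute_translation
    (commute_translation_convolutionOp μ) (commute_convolutionOp_convolutionOp μ)
    norm_translation_le (translation_mul_convolutionOp μ) hc hr hcr

/-- The continuous characters of a compact Hausdorff abelian group separate its points. -/
theorem exists_pontryaginDual_apply_ne_one [T2Space X] {x : X} (hx : x ≠ 1) :
    ∃ χ : PontryaginDual X, χ x ≠ 1 := by
  let _ : MeasurableSpace X := borel X
  have _ : BorelSpace X := ⟨rfl⟩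
  let μ : Measure X := Measure.haarMeasure ⊤
  have _ : IsProbabilityMeasure μ := ⟨Measure.haarMeasure_self⟩
  obtain ⟨g, hg⟩ : ∃ g : C(X, ℂ), translation x g - g ≠ 0 := by
    obtain ⟨g, hg0, hg1, -⟩ := exists_continuous_zero_one_of_isClosed
      (isClosed_singleton (x := x)) (isClosed_singleton (x := (1 : X)))
      (Set.disjoint_singleton.2 hx)
    refine ⟨⟨fun y => (g y : ℂ), by fun_prop⟩, fun h => ?_⟩
    have := DFunLike.congr_fun h x
    simp [hg0 rfl, hg1 rfl] at this
  -- For `f = translation x g - g`, the eigenvalue equation gives `l f = (ψ x - 1) * l g`. Both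
  -- factors are nonzero: the first gives `ψ x ≠ 1`, the second makes `ψ` continuous.
  obtain ⟨ψ, l, hψ, hl, hlg⟩ := exists_eigenfunctional μ hg
  rw [map_sub, ← hl, ← sub_one_mul] at hlg
  have hc : Continuous ψ := by
    have h1 : ∀ y, ψ y = l (translation y g) / l g := fun y => by
      rw [← hl, mul_div_cancel_right₀ _ (right_ne_zero_of_mul hlg)]
    exact (continuous_congr h1).2 ((l.continuous.comp (continuous_translation_apply g)).div_const _)
  obtain ⟨χ, hχ⟩ := exists_pontryaginDual_eq ψ hψ hc
  refine ⟨χ, fun h => left_ne_zero_of_mul hlg ?_⟩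
  rw [← hχ, h, Circle.coe_one, sub_self]

end PeterWeyl

/-! ### Coordinates and truncations of null sequences -/

namespace NullSeq

section Basic

variable {X : Type u} [CommGroup X] [TopologicalSpace X] [IsTopologicalGroup X]

/-- The element of `c₀(X)` given by a null sequence. -/
def mk (x : ℕ → X) (hx : Tendsto x atTop (𝓝 1)) : NullSeq X := ⟨UniformFun.ofFun x, hx⟩

theorem tendsto_coord (x : NullSeq X) : Tendsto (fun n => coord n x) atTop (𝓝 1) := x.2

theorem ext_coord {x y : NullSeq X} (h : ∀ n, coord n x = coord n y) : x = y :=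
  Subtype.ext (funext h)

theorem hasBasis_nhds_one_coord :
    (𝓝 (1 : NullSeq X)).HasBasis (fun V : Set X => V ∈ 𝓝 (1 : X))
      (fun V => {x : NullSeq X | ∀ n, coord n x ∈ V}) := hasBasis_nhds_one

theorem setOf_coord_mem_nhds_one {V : Set X} (hV : V ∈ 𝓝 (1 : X)) :
    {x : NullSeq X | ∀ n, coord n x ∈ V} ∈ 𝓝 (1 : NullSeq X) :=
  hasBasis_nhds_one_coord.mem_of_mem hV

theorem tendsto_mulSingle {X : Type u} [One X] [TopologicalSpace X] (n : ℕ) (x : X) : Tendsto (Pi.mulSingle n x : ℕ → X) atTop (𝓝 1) :=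
  tendsto_const_nhds.congr' <| (eventually_gt_atTop n).mono fun _ hm =>
    (Pi.mulSingle_eq_of_ne (M := fun _ => X) hm.ne' x).symm

/-- The sequence with value `x` at `n` and `1` elsewhere. -/
def single (n : ℕ) : X →* NullSeq X where
  toFun x := mk (Pi.mulSingle n x) (tendsto_mulSingle n x)
  map_one' := ext_coord fun m => congrFun (Pi.mulSingle_one (M := fun _ => X) n) m
  map_mul' x y := ext_coord fun m => congrFun (Pi.mulSingle_mul (f := fun _ => X) n x y) m

theorem coord_single_same (n : ℕ) (x : X) : coord n (single n x) = x :=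
  Pi.mulSingle_eq_same (M := fun _ => X) n x

theorem coord_single_of_ne {n m : ℕ} (h : m ≠ n) (x : X) : coord m (single n x) = 1 :=
  Pi.mulSingle_eq_of_ne (M := fun _ => X) h x

theorem coord_single_mem {V : Set X} (h1 : (1 : X) ∈ V) {x : X} (hx : x ∈ V) (n m : ℕ) :
    coord m (single n x) ∈ V := by
  rcases eq_or_ne m n with rfl | h
  · rwa [coord_single_same]
  · rwa [coord_single_of_ne h]

theorem continuous_single (n : ℕ) : Continuous (single (X := X) n) := by
  refine continuous_of_continuousAt_one _ ?_
  rw [ContinuousAt, map_one, hasBasis_nhds_one_coord.tendsto_right_iff]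
  intro V hV
  filter_upwards [hV] with x hx m
  exact coord_single_mem (mem_of_mem_nhds hV) hx n m

theorem coord_prod_single (s : Finset ℕ) (x : ℕ → X) (m : ℕ) :
    coord m (∏ n ∈ s, single n (x n)) = if m ∈ s then x m else 1 := by
  rw [map_prod]
  split_ifs with h
  · rw [Finset.prod_eq_single_of_mem m h fun n _ hn => coord_single_of_ne hn.symm _,
      coord_single_same]
  · exact Finset.prod_eq_one fun n hn =>
      coord_single_of_ne (fun hmn => h (by rwa [hmn])) _

/-- Every null sequence is the limit of its truncations. -/
theorem tendsto_prod_single (x : NullSeq X) :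
    Tendsto (fun N => ∏ n ∈ Finset.range N, single n (coord n x)) atTop (𝓝 x) := by
  suffices h : Tendsto (fun N => (∏ n ∈ Finset.range N, single n (coord n x)) / x) atTop (𝓝 1) by
    simpa using h.mul_const x
  rw [hasBasis_nhds_one_coord.tendsto_right_iff]
  intro V hV
  have hV' : V⁻¹ ∈ 𝓝 (1 : X) := inv_mem_nhds_one X hV
  obtain ⟨N, hN⟩ := eventually_atTop.1 ((tendsto_coord x).eventually_mem hV')
  filter_upwards [eventually_ge_atTop N] with M hM m
  rw [map_div, coord_prod_single]
  split_ifs with h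
  · rw [div_self']
    exact mem_of_mem_nhds hV
  · rw [one_div]
    exact hN m (hM.trans (not_lt.1 fun h' => h (Finset.mem_range.2 h')))

instance [T2Space X] : T2Space (NullSeq X) := by
  refine IsTopologicalGroup.t2Space_of_one_sep fun x hx => ?_
  obtain ⟨n, hn⟩ : ∃ n, coord n x ≠ 1 := by
    by_contra! h
    exact hx (ext_coord h)
  exact ⟨_, setOf_coord_mem_nhds_one (isOpen_ne.mem_nhds hn.symm), fun h => h n rfl⟩

end Basic

/-! ### Failure of precompactness -/

section NotPrecompact

variable {X : Type u} [CommGroup X] [TopologicalSpace X] [IsTopologicalGroup X]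

theorem not_isPrecompactGroup [T1Space X] [Nontrivial X] : ¬ IsPrecompactGroup (NullSeq X) := by
  intro hpre
  obtain ⟨x, hx⟩ := exists_ne (1 : X)
  obtain ⟨V, hV, hVx⟩ := exists_nhds_split_inv (isOpen_ne.mem_nhds hx.symm)
  obtain ⟨F, hF, hFU⟩ := hpre _ (setOf_coord_mem_nhds_one hV)
  have h1 : ∀ n, ∃ f : F, ∀ m, coord m (single n x) / coord m (f : NullSeq X) ∈ V := fun n => by
    obtain ⟨f, hf, u, hu, hfu⟩ := Set.mem_mul.1 (hFU ▸ Set.mem_univ (single n x))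
    refine ⟨⟨f, hf⟩, fun m => ?_⟩
    rw [← map_div, ← hfu, mul_div_cancel_left]
    exact hu m
  choose f hf using h1
  have := hF.to_subtype
  -- Two of the sequences share a translate; at index `n` their entries are `x` and `1`, so `x` is a
  -- quotient of elements of `V`.
  obtain ⟨n, m, hnm, hfnm⟩ := Finite.exists_ne_map_eq_of_infinite f
  have h2 := hVx _ (hf n n) _ (hf m n)
  rw [hfnm, div_div_div_cancel_right, coord_single_same, coord_single_of_ne hnm, div_one] at h2
  exact h2 rfl

end NotPrecompact

end NullSeq

/-! ### Local quasi-convexity -/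

section LocallyQuasiConvex

theorem Circle.exists_pow_re_neg {z : Circle} (hz : z ≠ 1) :
    ∃ n : ℕ, ((z ^ n : Circle) : ℂ).re < 0 := by
  by_contra! h
  refine hz (Circle.eq_one_of_forall_pow_mem_centeredArc_pi_div_two fun n _ => ?_)
  rw [Circle.mem_centeredArc (by linarith [Real.pi_pos]), Complex.abs_arg_lt_pi_div_two_iff]
  left
  -- If `z ^ n` were purely imaginary, its square would be `-1`.
  refine (h n).lt_of_ne' fun h0 => ?_
  have h1 := h (n * 2)
  rw [pow_mul, Circle.coe_pow, sq, Complex.mul_re, h0] at h1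
  have h2 := Circle.normSq_coe (z ^ n)
  rw [Complex.normSq_apply, h0] at h2
  linarith

theorem PontryaginDual.pow_apply {X : Type u} [CommGroup X] [TopologicalSpace X]
    (ξ : PontryaginDual X) (n : ℕ) (x : X) : (ξ ^ n) x = ξ x ^ n := by
  induction n with
  | zero => rw [pow_zero, pow_zero, PontryaginDual.one_apply]
  | succ n ih => rw [pow_succ, pow_succ, ← ih]; rfl

theorem PontryaginDual.continuous_re {X : Type u} [CommGroup X] [TopologicalSpace X]
    (ξ : PontryaginDual X) : Continuous fun x => (ξ x : ℂ).re :=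
  Complex.continuous_re.comp (continuous_subtype_val.comp (map_continuous ξ))

/-- The characters of a compact Hausdorff abelian group determine its topology. -/
theorem exists_finset_pontryaginDual_subset {X : Type u} [CommGroup X] [TopologicalSpace X]
    [IsTopologicalGroup X] [CompactSpace X] [T2Space X] {U : Set X} (hU : U ∈ 𝓝 (1 : X)) :
    ∃ I : Set (PontryaginDual X), I.Finite ∧ {x | ∀ ξ ∈ I, 0 ≤ (ξ x : ℂ).re} ⊆ U := by
  have hK : IsCompact (interior U)ᶜ := isOpen_interior.isClosed_compl.isCompact
  have h1 : (interior U)ᶜ ⊆ ⋃ ξ : PontryaginDual X, {x | (ξ x : ℂ).re < 0} := by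
    intro x hx
    have hx1 : x ≠ 1 := fun h => hx (h ▸ mem_interior_iff_mem_nhds.2 hU)
    obtain ⟨ξ, hξ⟩ := exists_pontryaginDual_apply_ne_one hx1
    obtain ⟨n, hn⟩ := Circle.exists_pow_re_neg hξ
    exact Set.mem_iUnion.2 ⟨ξ ^ n, by rwa [Set.mem_ofPred_eq, PontryaginDual.pow_apply]⟩
  obtain ⟨t, ht⟩ := hK.elim_finite_subcover _ (fun ξ : PontryaginDual X =>
    isOpen_lt ξ.continuous_re continuous_const) h1
  refine ⟨t, t.finite_toSet, fun x hx => ?_⟩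
  by_contra hxU
  obtain ⟨ξ, hξ⟩ := Set.mem_iUnion.1 (ht fun h => hxU (interior_subset h))
  obtain ⟨hξt, hξx⟩ := Set.mem_iUnion.1 hξ
  exact absurd (hx ξ hξt) (not_le.2 hξx)

theorem NullSeq.isLocallyQuasiConvex {X : Type u} [CommGroup X] [TopologicalSpace X]
    [IsTopologicalGroup X] [CompactSpace X] [T2Space X] : IsLocallyQuasiConvex (NullSeq X) := by
  refine hasBasis_self.2 fun W hW => ?_
  obtain ⟨U, hU, hUW⟩ := hasBasis_nhds_one_coord.mem_iff.1 hW
  obtain ⟨I, hI, hIU⟩ := exists_finset_pontryaginDual_subset hU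
  refine ⟨{x | ∀ n, ∀ ξ ∈ I, 0 ≤ (ξ (coord n x) : ℂ).re}, ?_, ?_, fun x hx => hUW fun n =>
    hIU (hx n)⟩
  · have h : ∀ᶠ x in 𝓝 (1 : X), ∀ ξ ∈ I, 0 ≤ (ξ x : ℂ).re :=
      (eventually_all_finite hI).2 fun ξ _ => (ξ.continuous_re.continuousAt.eventually
        (lt_mem_nhds (by simp))).mono fun x hx => le_of_lt hx
    exact setOf_coord_mem_nhds_one h
  · intro x hx
    simp only [Set.mem_ofPred_eq, not_forall] at hx
    obtain ⟨n, ξ, hξ, hx⟩ := hx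
    exact ⟨(ContinuousMonoidHom.comp ξ ⟨coord n, continuous_coord n⟩ : NullSeq X →ₜ* Circle),
      fun a ha => ha n ξ hξ, hx⟩

end LocallyQuasiConvex

/-! ### Polishness -/

section Polish

open scoped Uniformity

variable {X : Type u} [CommGroup X] [TopologicalSpace X] [IsTopologicalGroup X]

/-- Finitely supported sequences with entries in a countable dense set are dense, because
truncations converge. -/
theorem NullSeq.separableSpace [TopologicalSpace.SeparableSpace X] :
    TopologicalSpace.SeparableSpace (NullSeq X) := by
  obtain ⟨D, hD, hDd⟩ := TopologicalSpace.exists_countable_dense X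
  have := hD.to_subtype
  refine ⟨Set.range fun p : Σ N : ℕ, Fin N → D =>
    ∏ n : Fin p.1, single (n : ℕ) (p.2 n : X), Set.countable_range _, fun x => ?_⟩
  refine mem_closure_of_tendsto (tendsto_prod_single x) (Eventually.of_forall fun N => ?_) |>
    fun h => closure_closure.subset h
  have hc : Continuous fun y : Fin N → X => ∏ n : Fin N, single (n : ℕ) (y n) :=
    continuous_finsetProd _ fun n _ => (continuous_single _).comp (continuous_apply n)
  have hd : Dense (Set.univ.pi fun _ : Fin N => D) := dense_pi _ fun _ _ => hDd
  rw [Finset.prod_range]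
  refine closure_mono ?_ (image_closure_subset_closure_image hc
    ⟨fun n : Fin N => coord (n : ℕ) x, hd _, rfl⟩)
  rintro _ ⟨y, hy, rfl⟩
  exact ⟨⟨N, fun n => ⟨y n, hy n trivial⟩⟩, rfl⟩

theorem NullSeq.polishSpace [CompactSpace X] [TopologicalSpace.MetrizableSpace X] :
    PolishSpace (NullSeq X) := by
  let _ : UniformSpace X := IsTopologicalGroup.rightUniformSpace X
  have _ : IsUniformGroup X := isUniformGroup_of_commGroup
  have _ : (𝓤 X).IsCountablyGenerated := IsUniformGroup.uniformity_countably_generated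
  have _ : (𝓤 (ℕ →ᵤ X)).IsCountablyGenerated := by
    obtain ⟨V, hV⟩ := (𝓤 X).exists_antitone_basis
    exact (UniformFun.hasBasis_uniformity_of_basis ℕ X hV.1).isCountablyGenerated
  have hcl : IsClosedEmbedding (fun x : NullSeq X => (x : ℕ →ᵤ X)) := by
    refine ⟨⟨⟨rfl⟩, Subtype.val_injective⟩, isClosed_of_closure_subset fun x hx => ?_⟩
    have hx' : Tendsto (UniformFun.toFun x) atTop (𝓝 1) := by
      rw [Uniform.tendsto_nhds_right, tendsto_def]
      intro V hV
      obtain ⟨W, hW, hWs, hWV⟩ := comp_symm_mem_uniformity_sets hV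
      obtain ⟨_, ⟨y, rfl⟩, hy⟩ := (mem_closure_iff_nhds_basis
        (UniformFun.hasBasis_nhds ℕ X x)).1 hx W hW
      filter_upwards [(Uniform.tendsto_nhds_right.1 (tendsto_coord y)).eventually_mem hW] with n hn
      exact hWV ⟨_, hn, hWs.symm _ _ (hy n)⟩
    exact ⟨⟨x, hx'⟩, rfl⟩
  have _ := hcl.IsCompletelyMetrizableSpace
  have _ : SecondCountableTopology X := inferInstance
  have _ := NullSeq.separableSpace (X := X)
  infer_instance

end Polish

/-! ### Characters of `c₀(X)` for connected `X` -/

theorem Circle.exp_re (r : ℝ) : (Circle.exp r : ℂ).re = Real.cos r := by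
  rw [Circle.coe_exp, Complex.exp_ofReal_mul_I_re]

/-- The angle sums grow without bound in steps of at most `π / 2`, so the first one beyond `π / 2`
is at most `π`. -/
theorem Circle.exists_prod_re_neg {z : ℕ → Circle} {δ : ℝ} (hδ : 0 < δ)
    (h1 : ∀ k, δ ≤ Complex.arg (z k)) (h2 : ∀ k, Complex.arg (z k) ≤ Real.pi / 2) :
    ∃ k, ((∏ j ∈ Finset.range k, z j : Circle) : ℂ).re < 0 := by
  let S : ℕ → ℝ := fun k => ∑ j ∈ Finset.range k, Complex.arg (z j)
  have hS : ∀ k, ∏ j ∈ Finset.range k, z j = Circle.exp (S k) := by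
    intro k
    induction k with
    | zero => simp [S]
    | succ k ih =>
      rw [Finset.prod_range_succ, ih]
      simp only [S]
      rw [Finset.sum_range_succ, Circle.exp_add, Circle.exp_arg]
  have hSk : ∀ k : ℕ, k * δ ≤ S k := fun k => by
    simpa using Finset.card_nsmul_le_sum (Finset.range k) (fun j => Complex.arg (z j)) δ
      fun j _ => h1 j
  have hex : ∃ k, Real.pi / 2 < S k := by
    obtain ⟨k, hk⟩ := exists_nat_gt (Real.pi / 2 / δ)
    exact ⟨k, ((div_lt_iff₀ hδ).1 hk).trans_le (hSk k)⟩
  classical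
  have hk := Nat.find_spec hex
  have hmin := fun m => Nat.find_min (m := m) hex
  generalize Nat.find hex = k at hk hmin
  refine ⟨k, ?_⟩
  rw [hS, Circle.exp_re]
  refine Real.cos_neg_of_pi_div_two_lt_of_lt hk ?_
  cases k with
  | zero =>
    simp only [S, Finset.range_zero, Finset.sum_empty] at hk
    linarith [Real.pi_pos]
  | succ k =>
    have h3 := not_lt.1 (hmin k k.lt_succ_self)
    have h4 : S (k + 1) = S k + Complex.arg (z k) := Finset.sum_range_succ _ _
    linarith [h2 k, Real.pi_pos]

theorem Circle.norm_sub_one_le_abs_arg (z : Circle) : ‖(z : ℂ) - 1‖ ≤ |Complex.arg z| := by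
  have h := Real.norm_exp_I_mul_ofReal_sub_one_le (x := Complex.arg z)
  rwa [mul_comm, ← Circle.coe_exp, Circle.exp_arg, Real.norm_eq_abs] at h

theorem Circle.norm_mul_sub_one_le (z w : Circle) :
    ‖((z * w : Circle) : ℂ) - 1‖ ≤ ‖(z : ℂ) - 1‖ + ‖(w : ℂ) - 1‖ := by
  have h : ((z * w : Circle) : ℂ) - 1 = (z : ℂ) * ((w : ℂ) - 1) + ((z : ℂ) - 1) := by
    rw [Circle.coe_mul]
    ring
  rw [h, add_comm]
  refine (norm_add_le _ _).trans ?_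
  rw [norm_mul, Circle.norm_coe, one_mul]

section Connected

/-- `V` generates an open, hence closed, subgroup, which is all of `X` by connectedness; compactness
bounds the exponent. -/
theorem exists_pow_eq_univ {X : Type u} [CommGroup X] [TopologicalSpace X] [IsTopologicalGroup X]
    [CompactSpace X] [ConnectedSpace X] {V : Set X} (hV : V ∈ 𝓝 (1 : X))
    (hinv : V⁻¹ = V) : ∃ m : ℕ, V ^ m = Set.univ := by
  have h1 : (1 : X) ∈ V := mem_of_mem_nhds hV
  have htop : (Subgroup.closure V : Set X) = Set.univ := by
    have ho : IsOpen (Subgroup.closure V : Set X) :=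
      Subgroup.isOpen_of_mem_nhds _ (mem_of_superset hV Subgroup.subset_closure)
    exact IsClopen.eq_univ ⟨Subgroup.isClosed_of_isOpen _ ho, ho⟩ ⟨1, one_mem _⟩
  have hmem : ∀ x : X, ∃ m : ℕ, x ∈ V ^ m := fun x => by
    have hx : x ∈ Subgroup.closure V := SetLike.mem_coe.1 (htop ▸ Set.mem_univ x)
    induction hx using Subgroup.closure_induction with
    | mem x hx => exact ⟨1, by rwa [pow_one]⟩
    | one => exact ⟨0, by simp⟩
    | mul x y _ _ hx hy =>
      obtain ⟨m, hm⟩ := hx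
      obtain ⟨k, hk⟩ := hy
      exact ⟨m + k, by rw [pow_add]; exact Set.mul_mem_mul hm hk⟩
    | inv x _ hx =>
      obtain ⟨m, hm⟩ := hx
      exact ⟨m, by rwa [← hinv, inv_pow, Set.inv_mem_inv]⟩
  have hmono : Monotone fun m : ℕ => V ^ m := fun a b hab => Set.pow_subset_pow_right h1 hab
  obtain ⟨m, hm⟩ := isCompact_univ.elim_directed_cover (fun m : ℕ => interior (V ^ m))
    (fun _ => isOpen_interior) (fun x _ => by
      obtain ⟨m, hm⟩ := hmem x
      refine Set.mem_iUnion.2 ⟨m + 1, mem_interior_iff_mem_nhds.2 ?_⟩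
      rw [pow_succ]
      refine mem_of_superset (?_ : x • V ∈ 𝓝 x) (Set.smul_set_subset_mul hm)
      simpa using smul_mem_nhds_smul x hV)
    (Monotone.directed_le fun a b hab => interior_mono (hmono hab))
  exact ⟨m, Set.univ_subset_iff.1 (hm.trans interior_subset)⟩

/-- The bound does not depend on `ξ`. If `ξ` stayed closer to `1` on `V`, then `‖ξ - 1‖ ≤ m / (m +
1) < 1` on all of `X`, but some value of `ξ` has negative real part. -/
theorem exists_le_arg_of_ne_one {X : Type u} [CommGroup X] [TopologicalSpace X]
    {V : Set X} (hinv : V⁻¹ = V) {m : ℕ}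
    (hm : V ^ m = Set.univ) {ξ : PontryaginDual X} (hξ : ξ ≠ 1) :
    ∃ x ∈ V, 1 / ((m : ℝ) + 1) ≤ Complex.arg (ξ x) := by
  have hm0 : (0 : ℝ) < m + 1 := by positivity
  obtain ⟨x, hx⟩ : ∃ x, ξ x ≠ 1 := by
    by_contra! h
    exact hξ (PontryaginDual.ext h)
  obtain ⟨n, hn⟩ := Circle.exists_pow_re_neg hx
  obtain ⟨v, hv, hv1⟩ : ∃ v ∈ V, 1 / ((m : ℝ) + 1) < ‖(ξ v : ℂ) - 1‖ := by
    by_contra! h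
    have key : ∀ k : ℕ, ∀ y ∈ V ^ k, ‖(ξ y : ℂ) - 1‖ ≤ k * (1 / ((m : ℝ) + 1)) := by
      intro k
      induction k with
      | zero =>
        intro y hy
        rw [pow_zero, Set.mem_one] at hy
        simp [hy]
      | succ k ih =>
        intro y hy
        rw [pow_succ] at hy
        obtain ⟨a, ha, b, hb, rfl⟩ := Set.mem_mul.1 hy
        rw [map_mul]
        refine (Circle.norm_mul_sub_one_le _ _).trans ?_
        push_cast
        rw [add_one_mul]
        exact add_le_add (ih a ha) (h b hb)
    have h1 := key m (x ^ n) (hm ▸ Set.mem_univ _)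
    have h2 := Complex.abs_re_le_norm ((ξ (x ^ n) : ℂ) - 1)
    rw [map_pow] at h1 h2
    rw [Complex.sub_re, Complex.one_re, abs_of_neg (by linarith)] at h2
    have h3 : (m : ℝ) * (1 / ((m : ℝ) + 1)) < 1 := by
      rw [mul_one_div, div_lt_one hm0]
      linarith
    linarith
  have hv2 := hv1.le.trans (Circle.norm_sub_one_le_abs_arg (ξ v))
  rcases le_total 0 (Complex.arg (ξ v)) with h | h
  · exact ⟨v, hv, by rwa [abs_of_nonneg h] at hv2⟩
  -- Symmetry of `V` allows a positive sign for the angle.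
  · refine ⟨v⁻¹, by rwa [← hinv, Set.inv_mem_inv], ?_⟩
    rw [map_inv, Circle.coe_inv, Complex.arg_inv, if_neg (by linarith [Real.pi_pos])]
    rwa [abs_of_nonpos h] at hv2

end Connected

namespace NullSeq

variable {X : Type u} [CommGroup X] [TopologicalSpace X] [IsTopologicalGroup X]

/-- The restriction of a character of `c₀(X)` to the `n`-th coordinate. -/
noncomputable def restrict (κ : PontryaginDual (NullSeq X)) (n : ℕ) : PontryaginDual X :=
  (ContinuousMonoidHom.comp κ ⟨single n, continuous_single n⟩ : X →ₜ* Circle)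

theorem restrict_apply (κ : PontryaginDual (NullSeq X)) (n : ℕ) (x : X) :
    restrict κ n x = κ (single n x) := rfl

theorem ext_restrict {κ κ' : PontryaginDual (NullSeq X)}
    (h : ∀ n, restrict κ n = restrict κ' n) : κ = κ' := by
  refine PontryaginDual.ext fun x => ?_
  have h1 := ((map_continuous κ).tendsto x).comp (tendsto_prod_single x)
  have h2 := ((map_continuous κ').tendsto x).comp (tendsto_prod_single x)
  refine tendsto_nhds_unique h1 (h2.congr fun N => ?_)
  simp only [Function.comp_apply, map_prod, ← restrict_apply, h]

theorem restrict_chi (h : EventuallyOneSeq (PontryaginDual X)) (n : ℕ) :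
    restrict (chi X h) n = (h : ℕ → PontryaginDual X) n := by
  refine PontryaginDual.ext fun x => ?_
  change ∏ᶠ m, (h : ℕ → PontryaginDual X) m (coord m (single n x)) = _
  rw [finprod_eq_single _ n fun m hm => by rw [coord_single_of_ne hm, map_one],
    coord_single_same]

theorem chi_injective : Function.Injective (chi X) := fun h k hk =>
  Subtype.ext (funext fun n => by rw [← restrict_chi, hk, restrict_chi])

theorem coord_prod_single_mem {V : Set X} (h1 : (1 : X) ∈ V) {e : ℕ → ℕ}
    (he : Function.Injective e) {x : ℕ → X} (hx : ∀ j, x j ∈ V) (s : Finset ℕ) (m : ℕ) :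
    coord m (∏ j ∈ s, single (e j) (x j)) ∈ V := by
  rw [map_prod]
  by_cases h : ∃ j ∈ s, e j = m
  · obtain ⟨j, hj, rfl⟩ := h
    rw [Finset.prod_eq_single_of_mem j hj fun i _ hi =>
      coord_single_of_ne (fun hji => hi (he hji.symm)) _, coord_single_same]
    exact hx j
  · rw [Finset.prod_eq_one fun j hj => coord_single_of_ne (fun hm => h ⟨j, hj, hm.symm⟩) _]
    exact h1

/-- Otherwise one could place points of `V` at distinct indices and multiply uniformly large
rotations, leaving the right half-plane to which `κ` maps sequences in `V`. -/
theorem finite_restrict_ne_one [CompactSpace X] [ConnectedSpace X]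
    (κ : PontryaginDual (NullSeq X)) : {n | restrict κ n ≠ 1}.Finite := by
  by_contra hinf
  obtain ⟨V', hV', hVκ⟩ := hasBasis_nhds_one_coord.mem_iff.1
    (κ.continuous_re.continuousAt.eventually (lt_mem_nhds (a := 0) (by simp)))
  set V := V' ∩ V'⁻¹ with hVdef
  have hV : V ∈ 𝓝 (1 : X) := inter_mem hV' (inv_mem_nhds_one X hV')
  have hinv : V⁻¹ = V := by rw [hVdef, Set.inter_inv, inv_inv, Set.inter_comm]
  have h1 : (1 : X) ∈ V := mem_of_mem_nhds hV
  have hpos : ∀ x : NullSeq X, (∀ n, coord n x ∈ V) → 0 < (κ x : ℂ).re := fun x hx =>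
    hVκ fun n => (hx n).1
  obtain ⟨m, hm⟩ := exists_pow_eq_univ hV hinv
  let e := Set.Infinite.natEmbedding _ hinf
  choose x hxV hx using fun k => exists_le_arg_of_ne_one hinv hm (e k).2
  obtain ⟨k, hk⟩ := Circle.exists_prod_re_neg (z := fun k => restrict κ (e k) (x k))
    (by positivity) hx fun k => by
      refine (abs_le.1 (Complex.abs_arg_le_pi_div_two_iff.2 (le_of_lt ?_))).2
      exact hpos _ fun n => coord_single_mem h1 (hxV k) _ n
  refine lt_asymm hk ?_
  simp only [restrict_apply, ← map_prod]
  exact hpos _ (coord_prod_single_mem h1 (e := fun j => (e j : ℕ))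
    (Subtype.val_injective.comp e.injective) hxV _)

theorem chi_surjective [CompactSpace X] [ConnectedSpace X] : Function.Surjective (chi X) := by
  intro κ
  refine ⟨⟨restrict κ, ?_⟩, ext_restrict fun n => restrict_chi _ n⟩
  change ∀ᶠ n in atTop, restrict κ n = 1
  rw [← Nat.cofinite_eq_atTop, eventually_cofinite]
  exact finite_restrict_ne_one κ

end NullSeq

/-! ### Countability of the dual in the bijective case -/

section Countable

/-- The dual of a compact group is discrete, and here also second countable. -/
theorem PontryaginDual.countable (X : Type u) [CommGroup X] [TopologicalSpace X]
    [IsTopologicalGroup X] [CompactSpace X] [SecondCountableTopology X] :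
    Countable (PontryaginDual X) := by
  have h : SecondCountableTopology (X →ₜ* Circle) :=
    (ContinuousMonoidHom.isEmbedding_toContinuousMap X Circle).secondCountableTopology
  have h' : SecondCountableTopology (PontryaginDual X) := h
  exact TopologicalSpace.separableSpace_iff_countable.1 inferInstance

theorem PontryaginDual.nontrivial (X : Type u) [CommGroup X] [TopologicalSpace X]
    [IsTopologicalGroup X] [CompactSpace X] [T2Space X] [Nontrivial X] :
    Nontrivial (PontryaginDual X) := by
  obtain ⟨x, hx⟩ := exists_ne (1 : X)
  obtain ⟨ξ, hξ⟩ := exists_pontryaginDual_apply_ne_one hx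
  exact ⟨ξ, 1, fun h => hξ (by rw [h, PontryaginDual.one_apply])⟩

theorem EventuallyOneSeq.countable (A : Type u) [CommGroup A] [Countable A] :
    Countable (EventuallyOneSeq A) := by
  let f : EventuallyOneSeq A → Σ N : ℕ, Fin N → A := fun h =>
    ⟨(eventually_atTop.1 h.2).choose, fun n => (h : ℕ → A) n⟩
  have hf : ∀ (h : EventuallyOneSeq A) (n : ℕ),
      (h : ℕ → A) n = if hn : n < (f h).1 then (f h).2 ⟨n, hn⟩ else 1 := fun h n => by
    split_ifs with hn
    · rfl
    · exact (eventually_atTop.1 h.2).choose_spec n (not_lt.1 hn)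
  refine Function.Injective.countable (f := f) fun h k hhk => Subtype.ext (funext fun n => ?_)
  rw [hf h, hf k, hhk]

theorem EventuallyOneSeq.infinite (A : Type u) [CommGroup A] [Nontrivial A] :
    Infinite (EventuallyOneSeq A) := by
  obtain ⟨a, ha⟩ := exists_ne (1 : A)
  refine Infinite.of_injective (fun n : ℕ => (⟨Pi.mulSingle n a,
    (eventually_gt_atTop n).mono fun _ hm => Pi.mulSingle_eq_of_ne (M := fun _ => A) hm.ne' a⟩ :
      EventuallyOneSeq A)) fun n m hnm => ?_
  by_contra hne
  have h := congrFun (Subtype.ext_iff.1 hnm) n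
  exact ha ((Pi.mulSingle_eq_same (M := fun _ => A) n a).symm.trans
    (h.trans (Pi.mulSingle_eq_of_ne (M := fun _ => A) hne a)))

theorem NullSeq.mk_pontryaginDual_of_bijective {X : Type u} [CommGroup X] [TopologicalSpace X]
    [IsTopologicalGroup X] [CompactSpace X] [T2Space X] [SecondCountableTopology X]
    [Nontrivial X] (h : Function.Bijective (chi X)) : #(PontryaginDual (NullSeq X)) = ℵ₀ := by
  have := PontryaginDual.countable X
  have := PontryaginDual.nontrivial X
  have := EventuallyOneSeq.countable (PontryaginDual X)
  have := EventuallyOneSeq.infinite (PontryaginDual X)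
  rw [← Cardinal.mk_congr (Equiv.ofBijective _ h)]
  exact Cardinal.mk_eq_aleph0 _

end Countable

/-! ### The dual for disconnected `X` -/

section Continuum

theorem PontryaginDual.mk_le_continuum (G : Type u) [CommGroup G] [TopologicalSpace G]
    [TopologicalSpace.SeparableSpace G] : #(PontryaginDual G) ≤ 𝔠 := by
  let f : PontryaginDual G → ℕ → ℂ := fun κ n => κ (TopologicalSpace.denseSeq G n)
  have hf : Function.Injective f := fun κ κ' h => by
    refine DFunLike.coe_injective (Continuous.ext_on (TopologicalSpace.denseRange_denseSeq G)
      (map_continuous κ) (map_continuous κ') ?_)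
    rintro _ ⟨n, rfl⟩
    exact Circle.ext (congrFun h n)
  have h := Cardinal.lift_mk_le_lift_mk_of_injective hf
  rwa [← Cardinal.power_def, Cardinal.mk_complex, Cardinal.mk_nat,
    Cardinal.continuum_power_aleph0, Cardinal.lift_continuum, Cardinal.lift_uzero] at h

/-- A disconnected compact abelian group has a non-trivial character with open kernel. -/
theorem exists_monoidHom_circle_of_not_connectedSpace {X : Type u} [CommGroup X]
    [TopologicalSpace X] [IsTopologicalGroup X] [CompactSpace X] (hX : ¬ ConnectedSpace X) :
    ∃ ξ : X →* Circle, (ξ.ker : Set X) ∈ 𝓝 (1 : X) ∧ ξ ≠ 1 := by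
  have hpre : ¬ PreconnectedSpace X := fun h => hX { h with toNonempty := ⟨1⟩ }
  rw [preconnectedSpace_iff_clopen] at hpre
  push Not at hpre
  obtain ⟨W, hW, hne, huniv⟩ : ∃ W : Set X, IsClopen W ∧ 1 ∈ W ∧ W ≠ Set.univ := by
    obtain ⟨W, hW, hne, huniv⟩ := hpre
    by_cases h1 : (1 : X) ∈ W
    · exact ⟨W, hW, h1, huniv⟩
    · exact ⟨Wᶜ, hW.compl, h1, fun h => hne.ne_empty (Set.compl_univ_iff.1 h)⟩
  -- A clopen neighbourhood of `1` contains an open subgroup; its quotient is finite and nontrivial,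
  -- so characters of finite abelian groups suffice.
  obtain ⟨H, hHW⟩ := IsTopologicalGroup.exist_openSubgroup_sub_clopen_nhds_of_one hW hne
  obtain ⟨x, hx⟩ := (Set.ne_univ_iff_exists_notMem W).1 huniv
  have hxH : (x : X ⧸ H.toSubgroup) ≠ 1 := fun h =>
    hx (hHW ((QuotientGroup.eq_one_iff x).1 h))
  have : Finite (X ⧸ H.toSubgroup) := H.toSubgroup.quotient_finite_of_isOpen H.isOpen'
  obtain ⟨φ, hφ⟩ := CommGroup.exists_apply_ne_one_of_hasEnoughRootsOfUnity
    (X ⧸ H.toSubgroup) Circle hxH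
  refine ⟨((Units.coeHom Circle).comp φ).comp (QuotientGroup.mk' H.toSubgroup),
    mem_of_superset (H.isOpen'.mem_nhds H.one_mem') fun y hy => ?_, fun h => hφ ?_⟩
  · rw [SetLike.mem_coe, MonoidHom.mem_ker, MonoidHom.comp_apply, QuotientGroup.mk'_apply,
      (QuotientGroup.eq_one_iff y).2 hy, map_one]
  · exact Units.ext (DFunLike.congr_fun h x)

namespace NullSeq

variable {X : Type u} [CommGroup X] [TopologicalSpace X] [IsTopologicalGroup X]

open Classical in
/-- The character `x ↦ ∏_{n ∈ A} ξ(xₙ)`, for a character `ξ` with open kernel. -/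
noncomputable def prodChar (ξ : X →* Circle) (hξ : (ξ.ker : Set X) ∈ 𝓝 (1 : X)) (A : Set ℕ) :
    NullSeq X →ₜ* Circle :=
  let f : NullSeq X →* Circle :=
    { toFun := fun x => ∏ᶠ n, if n ∈ A then ξ (coord n x) else 1
      map_one' := by simp
      map_mul' := fun x y => by
        have hfin : ∀ z : NullSeq X, (Function.mulSupport fun n =>
            if n ∈ A then ξ (coord n z) else 1).Finite := fun z => by
          have h := (tendsto_coord z).eventually_mem hξ
          rw [← Nat.cofinite_eq_atTop, eventually_cofinite] at h
          refine h.subset fun n hn hk => hn ?_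
          simp only
          rw [MonoidHom.mem_ker.1 hk, ite_self]
        rw [← finprod_mul_distrib (hfin x) (hfin y)]
        refine finprod_congr fun n => ?_
        split_ifs <;> simp }
  { f with
    continuous_toFun := by
      -- The character is identically `1` on the neighbourhood of sequences with all entries in
      -- `ξ.ker`.
      refine continuous_of_continuousAt_one f (tendsto_nhds_of_eventually_eq ?_)
      filter_upwards [setOf_coord_mem_nhds_one hξ] with x hx
      rw [map_one]
      refine finprod_eq_one_of_forall_eq_one fun n => ?_
      rw [MonoidHom.mem_ker.1 (hx n), ite_self] }

open Classical in
theorem prodChar_single (ξ : X →* Circle) (hξ : (ξ.ker : Set X) ∈ 𝓝 (1 : X)) (A : Set ℕ)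
    (n : ℕ) (x : X) : prodChar ξ hξ A (single n x) = if n ∈ A then ξ x else 1 := by
  change (∏ᶠ m, if m ∈ A then ξ (coord m (single n x)) else 1) = _
  rw [finprod_eq_single _ n fun m hm => by rw [coord_single_of_ne hm, map_one, ite_self],
    coord_single_same]

/-- Different index sets give different characters, as seen on a sequence supported at one index. -/
theorem mk_pontryaginDual_of_not_connectedSpace [CompactSpace X]
    [TopologicalSpace.SeparableSpace X] (hX : ¬ ConnectedSpace X) :
    #(PontryaginDual (NullSeq X)) = 𝔠 := by
  have := separableSpace (X := X)
  refine le_antisymm (PontryaginDual.mk_le_continuum _) ?_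
  obtain ⟨ξ, hξ, hξ1⟩ := exists_monoidHom_circle_of_not_connectedSpace hX
  obtain ⟨x, hx⟩ : ∃ x, ξ x ≠ 1 := by
    by_contra! h
    exact hξ1 (MonoidHom.ext h)
  let f : Set ℕ → PontryaginDual (NullSeq X) := fun A => prodChar ξ hξ A
  have hf : Function.Injective f := fun A B hAB => by
    classical
    ext n
    have h : prodChar ξ hξ A (single n x) = prodChar ξ hξ B (single n x) :=
      DFunLike.congr_fun hAB (single n x)
    rw [prodChar_single, prodChar_single] at h
    by_cases hA : n ∈ A <;> by_cases hB : n ∈ B <;> simp_all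
  have h := Cardinal.lift_mk_le_lift_mk_of_injective hf
  rwa [Cardinal.mk_set, Cardinal.mk_nat, Cardinal.two_power_aleph0, Cardinal.lift_continuum,
    Cardinal.lift_uzero] at h

end NullSeq

end Continuum

theorem mainTheorem3 (X : Type u) [CommGroup X] [TopologicalSpace X] [IsTopologicalGroup X]
    [CompactSpace X] [TopologicalSpace.MetrizableSpace X] [Infinite X] :
    (¬ IsPrecompactGroup (NullSeq X) ∧ IsLocallyQuasiConvex (NullSeq X) ∧
      PolishSpace (NullSeq X)) ∧
    List.TFAE [
      ConnectedSpace X,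
      Function.Bijective (NullSeq.chi X),
      #(PontryaginDual (NullSeq X)) = ℵ₀,
      #(PontryaginDual (NullSeq X)) < 𝔠] ∧
    (¬ ConnectedSpace X → #(PontryaginDual (NullSeq X)) = 𝔠) := by
  refine ⟨⟨NullSeq.not_isPrecompactGroup, NullSeq.isLocallyQuasiConvex, NullSeq.polishSpace⟩,
    ?_, NullSeq.mk_pontryaginDual_of_not_connectedSpace⟩
  tfae_have 1 → 2 := fun _ => ⟨NullSeq.chi_injective, NullSeq.chi_surjective⟩
  tfae_have 2 → 3 := NullSeq.mk_pontryaginDual_of_bijective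
  tfae_have 3 → 4 := fun h => h ▸ Cardinal.aleph0_lt_continuum
  tfae_have 4 → 1 := fun h => by
    by_contra hX
    exact h.ne (NullSeq.mk_pontryaginDual_of_not_connectedSpace hX)
  tfae_finish
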